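/- Let $D$ be a finite (nonempty) distributive lattice. Then there is a finite (nonempty) planar semimodular lattice $K$ such that $D$ is isomorphic to $\operatorname{Con} K$, the lattice of all congruences of $K$ ordered by inclusion. Here a finite lattice is called planar if it has a Hasse diagram in the plane, with distinct points for the elements and each covering pair $a \prec b$ drawn as a straight line segment ascending from $a$ to $b$, in which the segments meet each other and the points of the diagram only at their endpoints; and a lattice is called semimodular if $a \wedge b \prec a$ implies $b \prec a \vee b$. -/

import Mathlib

namespace LatticeCon

variable {K : Type*} [Lattice K]

theorem toSetoid_injective :
    Function.Injective (LatticeCon.toSetoid : LatticeCon K → Setoid K) := by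
  rintro ⟨s, _, _⟩ ⟨t, _, _⟩ h
  cases h
  rfl

/-- Congruences are ordered by inclusion: `c ≤ d` iff every pair of elements
that is congruent modulo `c` is congruent modulo `d`. -/
instance instPartialOrder : PartialOrder (LatticeCon K) where
  le c d := ∀ ⦃x y : K⦄, c.r x y → d.r x y
  le_refl _ _ _ h := h
  le_trans _ _ _ h₁ h₂ _ _ h := h₂ (h₁ h)
  le_antisymm _ _ h₁ h₂ :=
    toSetoid_injective (Setoid.ext fun _ _ => ⟨fun h => h₁ h, fun h => h₂ h⟩)

/-- The intersection of a set of congruences. -/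
instance instInfSet : InfSet (LatticeCon K) where
  sInf S :=
    { r := fun x y => ∀ c ∈ S, c.r x y
      iseqv :=
        ⟨fun x c _ => c.iseqv.refl x, fun h c hc => c.iseqv.symm (h c hc),
          fun h₁ h₂ c hc => c.iseqv.trans (h₁ c hc) (h₂ c hc)⟩
      inf := fun h₁ h₂ c hc => c.inf (h₁ c hc) (h₂ c hc)
      sup := fun h₁ h₂ c hc => c.sup (h₁ c hc) (h₂ c hc) }

theorem isGLB_sInf_set (S : Set (LatticeCon K)) : IsGLB S (sInf S) :=
  ⟨fun _ hc _ _ h => h _ hc, fun _ hd _ _ h c hc => hd hc h⟩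

/-- The congruence lattice `Con K`: the congruences of `K`, ordered by inclusion. -/
instance instCompleteLattice : CompleteLattice (LatticeCon K) :=
  completeLatticeOfInf (LatticeCon K) isGLB_sInf_set

end LatticeCon

/-- `p` is a planar Hasse diagram of the order `K`: the elements are drawn as distinct points
of the plane, every covering pair `a ⋖ b` is drawn as the straight line segment from `p a`
to `p b`, with `b` higher than `a`, and these segments meet each other and the points of the
diagram only at their endpoints. -/
structure IsPlanarDiagram {K : Type*} [PartialOrder K] (p : K → ℝ × ℝ) : Prop where
  injective : Function.Injective p
  upward : ∀ ⦃a b : K⦄, a ⋖ b → (p a).2 < (p b).2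
  notMem_edge : ∀ ⦃a b : K⦄, a ⋖ b → ∀ c : K, p c ∉ openSegment ℝ (p a) (p b)
  disjoint_edges : ∀ ⦃a b c d : K⦄, a ⋖ b → c ⋖ d → (a, b) ≠ (c, d) →
    Disjoint (openSegment ℝ (p a) (p b)) (openSegment ℝ (p c) (p d))

/-- An order is planar if it has a planar Hasse diagram. -/
def IsPlanarOrder (K : Type*) [PartialOrder K] : Prop :=
  ∃ p : K → ℝ × ℝ, IsPlanarDiagram p

/-! By Birkhoff's theorem `D` is the lattice of lower sets of the finite poset `P` of its
join-irreducibles, so it is enough to realize `LowerSet P` as a congruence lattice. The construction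
starts from the square of a finite chain whose steps are coloured by `P`. A congruence of such a
grid is determined by the steps it collapses in each of the two coordinates (`le_of_row_of_col`),
and two devices tie these steps together.

An eye in a cell turns the cell into an `M₃`, so the two steps spanning the cell collapse together.
The first `n` steps carry all colours; placing eyes in the equally coloured cells over them forces
steps of equal colour to collapse together.

A fork at the diagonal point `(k, k)` deletes the points `(k, b)` and `(b, k)` with `k < b`.
Collapsing step `k - 1` then forces step `k` to collapse (`Row.of_fork`), but not conversely. With a
fork for every `p ≤ q`, the collapsed colours form a lower set. Beyond `n`, a diagonal eye (before a
fork point) or the fork itself (after it) ties the steps of the two coordinates.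

Conversely, every lower set of colours gives a congruence of the grid (`gridCon`), which extends
over the eyes (`extend`). Semimodularity is local: covers in the grid are unit steps and eyes sit in
covering squares. Planarity follows because the order has dimension at most two, by
`isPlanarOrder_of_le_iff`. -/

/-! ### Planarity of lattices of order dimension at most two. -/

section Planarity

variable {K : Type*} {f g : K → ℝ}

theorem coords_of_mem_openSegment {a b : K} {z : ℝ × ℝ}
    (hz : z ∈ openSegment ℝ (f a, f a + g a) (f b, f b + g b)) :
    ∃ t : ℝ, 0 < t ∧ t < 1 ∧ z.1 = f a + t * (f b - f a) ∧
      z.2 - z.1 = g a + t * (g b - g a) := by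
  obtain ⟨s, t, hs, ht, hst, rfl⟩ := hz
  obtain rfl : s = 1 - t := by linarith
  refine ⟨t, ht, by linarith, ?_, ?_⟩ <;> simp <;> ring

theorem between_of_coords {a b t z : ℝ} (h : a ≤ b) (ht : 0 < t) (ht' : t < 1)
    (hz : z = a + t * (b - a)) : a ≤ z ∧ z ≤ b := by
  constructor <;> nlinarith

/-- If segments from `a` to `b` and to `d` meet at parameters `t ≥ s > 0`, then `d - a` is `t / s ≥
1` times the nonnegative vector `b - a`, so `d` dominates `b`. -/
theorem le_of_common_point_bot [PartialOrder K] (h : ∀ a b : K, a ≤ b ↔ f a ≤ f b ∧ g a ≤ g b) {a b d : K}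
    (hab : a ≤ b) {s t : ℝ} (ht : 0 < s) (hst : s ≤ t)
    (hf : t * (f b - f a) = s * (f d - f a)) (hg : t * (g b - g a) = s * (g d - g a)) :
    b ≤ d := by
  obtain ⟨h1, h2⟩ := (h _ _).1 hab
  refine (h _ _).2 ⟨?_, ?_⟩
  · have : s * (f b - f a) ≤ s * (f d - f a) := by nlinarith
    linarith [le_of_mul_le_mul_left this ht]
  · have : s * (g b - g a) ≤ s * (g d - g a) := by nlinarith
    linarith [le_of_mul_le_mul_left this ht]

theorem le_of_common_point_top [PartialOrder K] (h : ∀ a b : K, a ≤ b ↔ f a ≤ f b ∧ g a ≤ g b) {a b c : K}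
    (hab : a ≤ b) {s t : ℝ} (ht : 0 < s) (hst : s ≤ t)
    (hf : t * (f b - f a) = s * (f b - f c)) (hg : t * (g b - g a) = s * (g b - g c)) :
    c ≤ a := by
  obtain ⟨h1, h2⟩ := (h _ _).1 hab
  refine (h _ _).2 ⟨?_, ?_⟩
  · have : s * (f b - f a) ≤ s * (f b - f c) := by nlinarith
    linarith [le_of_mul_le_mul_left this ht]
  · have : s * (g b - g a) ≤ s * (g b - g c) := by nlinarith
    linarith [le_of_mul_le_mul_left this ht]

end Planarity

/-- A lattice of order dimension at most two is planar: the dominance drawing, turned by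
a linear map, is a planar diagram. -/
theorem isPlanarOrder_of_le_iff {K : Type*} [Lattice K] {f g : K → ℝ}
    (h : ∀ a b : K, a ≤ b ↔ f a ≤ f b ∧ g a ≤ g b) : IsPlanarOrder K := by
  have hsegment : ∀ {a b : K} {z : ℝ × ℝ}, a ≤ b →
      z ∈ openSegment ℝ (f a, f a + g a) (f b, f b + g b) →
      (f a ≤ z.1 ∧ z.1 ≤ f b) ∧ g a ≤ z.2 - z.1 ∧ z.2 - z.1 ≤ g b := by
    intro a b z hab hz
    obtain ⟨t, ht, ht', h1, h2⟩ := coords_of_mem_openSegment hz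
    obtain ⟨hf, hg⟩ := (h _ _).1 hab
    exact ⟨between_of_coords hf ht ht' h1, between_of_coords hg ht ht' h2⟩
  -- The first edge stays below `b` in both coordinates, so a point of it inside the edge from `b`
  -- to `c` would force `c ≤ b`.
  have hconsecutive : ∀ {a b c : K} {z : ℝ × ℝ}, a ⋖ b → b ⋖ c →
      z ∈ openSegment ℝ (f a, f a + g a) (f b, f b + g b) →
      z ∈ openSegment ℝ (f b, f b + g b) (f c, f c + g c) → False := by
    intro a b c z hab hbc h1 h2
    have l1 := hsegment hab.le h1
    obtain ⟨t, ht, ht', h3, h4⟩ := coords_of_mem_openSegment h2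
    refine hbc.lt.not_ge ((h _ _).2 ⟨?_, ?_⟩)
    · have : t * (f c - f b) ≤ t * 0 := by linarith [l1.1.2]
      linarith [le_of_mul_le_mul_left this ht]
    · have : t * (g c - g b) ≤ t * 0 := by linarith [l1.2.2]
      linarith [le_of_mul_le_mul_left this ht]
  refine ⟨fun a => (f a, f a + g a), ?_, ?_, ?_, ?_⟩
  · intro a b hab
    obtain ⟨h1, h2⟩ := Prod.ext_iff.1 hab
    simp only at h1 h2
    exact le_antisymm ((h _ _).2 ⟨h1.le, by linarith⟩) ((h _ _).2 ⟨h1.ge, by linarith⟩)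
  · intro a b hab
    obtain ⟨h1, h2⟩ := (h _ _).1 hab.le
    by_contra! h3
    simp only at h3
    exact hab.lt.not_ge ((h _ _).2 ⟨by linarith, by linarith⟩)
  · intro a b hab c hc
    have l := hsegment hab.le hc
    simp only at l
    have hac : a ≤ c := (h _ _).2 ⟨l.1.1, by linarith [l.2.1]⟩
    have hcb : c ≤ b := (h _ _).2 ⟨l.1.2, by linarith [l.2.2]⟩
    obtain ⟨t, ht, ht', h3, h4⟩ := coords_of_mem_openSegment hc
    simp only at h3 h4
    rcases hab.eq_or_eq hac hcb with rfl | rfl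
    · refine hab.lt.not_ge ((h _ _).2 ⟨?_, ?_⟩)
      · have : t * (f b - f c) ≤ t * 0 := by linarith
        linarith [le_of_mul_le_mul_left this ht]
      · have : t * (g b - g c) ≤ t * 0 := by linarith
        linarith [le_of_mul_le_mul_left this ht]
    · refine hab.lt.not_ge ((h _ _).2 ⟨?_, ?_⟩)
      · have : (1 - t) * (f c - f a) ≤ (1 - t) * 0 := by linarith
        linarith [le_of_mul_le_mul_left this (by linarith)]
      · have : (1 - t) * (g c - g a) ≤ (1 - t) * 0 := by linarith
        linarith [le_of_mul_le_mul_left this (by linarith)]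
  · intro a b c d hab hcd hne
    rw [Set.disjoint_left]
    intro z hz hz'
    have l := hsegment hab.le hz
    have l' := hsegment hcd.le hz'
    have had : a ≤ d := (h _ _).2 ⟨l.1.1.trans l'.1.2, l.2.1.trans l'.2.2⟩
    have hcb : c ≤ b := (h _ _).2 ⟨l'.1.1.trans l.1.2, l'.2.1.trans l.2.2⟩
    obtain ⟨t, ht, ht', h3, h4⟩ := coords_of_mem_openSegment hz
    obtain ⟨s, hs, hs', h5, h6⟩ := coords_of_mem_openSegment hz'
    -- A common point gives `a ≤ d` and `c ≤ b`. The join `a ⊔ c` lies between `a` and `b`, hence is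
    -- one of them; here the existence of joins is essential. The edges then share an end or are
    -- consecutive.
    rcases hab.eq_or_eq le_sup_left (sup_le hab.le hcb) with e | e
    · have hca : c ≤ a := sup_eq_left.1 e
      rcases hcd.eq_or_eq hca had with rfl | rfl
      · refine hne (Prod.ext rfl ?_)
        rcases le_total s t with hst | hst
        · exact (hcd.eq_or_eq hab.le
            (le_of_common_point_bot h hab.le hs hst (by linarith) (by linarith))).resolve_left
              hab.lt.ne'
        · exact ((hab.eq_or_eq hcd.le
            (le_of_common_point_bot h hcd.le ht hst (by linarith) (by linarith))).resolve_left
              hcd.lt.ne').symm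
      · exact hconsecutive hcd hab hz' hz
    · have hbd : b ≤ d := by
        rw [← e]; exact sup_le had hcd.le
      rcases hcd.eq_or_eq hcb hbd with rfl | rfl
      · exact hconsecutive hab hcd hz hz'
      · refine hne (Prod.ext ?_ rfl)
        rcases le_total s t with hst | hst
        · exact ((hab.eq_or_eq (le_of_common_point_top h hcd.le (s := 1 - t) (t := 1 - s)
            (by linarith) (by linarith) (by linarith) (by linarith)) hcd.le).resolve_right
              hcd.lt.ne).symm
        · exact (hcd.eq_or_eq (le_of_common_point_top h hab.le (s := 1 - s) (t := 1 - t)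
            (by linarith) (by linarith) (by linarith) (by linarith)) hab.le).resolve_right
              hab.lt.ne

/-! ### Local criterion for semimodularity. -/

/-- A finite lattice is semimodular if any two covers of an element
are covered by their join. -/
theorem isUpperModularLattice_of_covBy {K : Type*} [Lattice K] [Finite K]
    (h : ∀ ⦃c a b : K⦄, c ⋖ a → c ⋖ b → a ≠ b → a ⋖ a ⊔ b) : IsUpperModularLattice K := by
  -- Induction from the top on the meet `c`: replace `a` by `a ⊔ b'`, where `b'` covers `c` below
  -- `b`, which raises the meet to `b'`.
  have key : ∀ b : K, ∀ c, c ≤ b → ∀ a, a ⊓ b = c → c ⋖ a → b ⋖ a ⊔ b := by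
    intro b c
    induction c using (wellFounded_gt (α := K)).induction with
    | _ c ih =>
      intro hcb a hab hca
      rcases hcb.eq_or_lt with rfl | hlt
      · rwa [sup_eq_left.2 hca.le]
      · obtain ⟨b', hcb', hb'⟩ := exists_covBy_le_of_lt hlt
        have hne : a ≠ b' := by
          rintro rfl
          exact hca.lt.ne (hab.symm.trans (inf_eq_left.2 hb'))
        have hcov : b' ⋖ a ⊔ b' := by
          rw [sup_comm]; exact h hcb' hca hne.symm
        have hnle : ¬ a ⊔ b' ≤ b := fun hle =>
          hca.lt.ne (hab.symm.trans (inf_eq_left.2 (le_sup_left.trans hle)))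
        have hinf : (a ⊔ b') ⊓ b = b' := by
          refine (hcov.eq_or_eq (le_inf le_sup_right hb') inf_le_left).resolve_right fun e => ?_
          exact hnle (inf_eq_left.1 e)
        have := ih b' hcb'.lt hb' (a ⊔ b') hinf hcov
        rwa [sup_assoc, sup_eq_right.2 hb'] at this
  exact ⟨fun {a b} hab => key b _ inf_le_right a rfl hab⟩

/-! ### Adding eyes to a lattice. -/

/-- A family of pairs of incomparable elements of a lattice. Each member `e` is going to be
turned into an eye: a new element between `left e ⊓ right e` and `left e ⊔ right e`. -/
structure EyeFamily (L E : Type*) [Lattice L] where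
  left : E → L
  right : E → L
  not_left_le : ∀ e, ¬ left e ≤ right e
  not_right_le : ∀ e, ¬ right e ≤ left e

namespace EyeFamily

variable {L E : Type*} [Lattice L] (F : EyeFamily L E)

/-- The bottom of the interval of an eye. -/
def bot (e : E) : L := F.left e ⊓ F.right e

/-- The top of the interval of an eye. -/
def top (e : E) : L := F.left e ⊔ F.right e

theorem bot_lt_top (e : E) : F.bot e < F.top e :=
  inf_lt_sup.2 fun h => F.not_left_le e h.le

theorem bot_le_left (e : E) : F.bot e ≤ F.left e := inf_le_left

theorem bot_le_right (e : E) : F.bot e ≤ F.right e := inf_le_right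

theorem left_le_top (e : E) : F.left e ≤ F.top e := le_sup_left

theorem right_le_top (e : E) : F.right e ≤ F.top e := le_sup_right

/-- The lattice `L` with a new element for each eye of the family `F`. -/
def Eyed (_ : EyeFamily L E) : Type _ := L ⊕ E

namespace Eyed

variable {F}

/-- The inclusion of `L`. -/
def base (x : L) : F.Eyed := Sum.inl x

/-- The new element of an eye. -/
def eye (e : E) : F.Eyed := Sum.inr e

/-- The largest element of `L` below. -/
def lower (u : F.Eyed) : L := Sum.elim id F.bot u

/-- The smallest element of `L` above. -/
def upper (u : F.Eyed) : L := Sum.elim id F.top u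

@[simp] theorem lower_base (x : L) : (base x : F.Eyed).lower = x := rfl
@[simp] theorem upper_base (x : L) : (base x : F.Eyed).upper = x := rfl
@[simp] theorem lower_eye (e : E) : (eye e : F.Eyed).lower = F.bot e := rfl
@[simp] theorem upper_eye (e : E) : (eye e : F.Eyed).upper = F.top e := rfl

theorem base_or_eye (u : F.Eyed) : (∃ x, u = base x) ∨ ∃ e, u = eye e := by
  rcases u with x | e
  exacts [.inl ⟨x, rfl⟩, .inr ⟨e, rfl⟩]

theorem base_injective : Function.Injective (base : L → F.Eyed) := Sum.inl_injective

theorem eye_injective : Function.Injective (eye : E → F.Eyed) := Sum.inr_injective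

theorem base_ne_eye (x : L) (e : E) : (base x : F.Eyed) ≠ eye e := Sum.inl_ne_inr

theorem lower_le_upper (u : F.Eyed) : u.lower ≤ u.upper := by
  rcases base_or_eye u with ⟨x, rfl⟩ | ⟨e, rfl⟩
  exacts [le_rfl, (F.bot_lt_top e).le]

theorem eq_base_of_upper_le_lower {u : F.Eyed} (h : u.upper ≤ u.lower) :
    u = base u.upper := by
  rcases base_or_eye u with ⟨x, rfl⟩ | ⟨e, rfl⟩
  exacts [rfl, absurd h (F.bot_lt_top e).not_ge]

instance [Finite L] [Finite E] : Finite F.Eyed := inferInstanceAs (Finite (L ⊕ E))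

instance : PartialOrder F.Eyed where
  le u v := u = v ∨ u.upper ≤ v.lower
  le_refl u := .inl rfl
  le_trans u v w := by
    rintro (rfl | h) (rfl | h')
    exacts [.inl rfl, .inr h', .inr h, .inr (h.trans (v.lower_le_upper.trans h'))]
  le_antisymm u v := by
    rintro (h | h) (h' | h')
    · exact h
    · exact h
    · exact h'.symm
    · have hu := u.lower_le_upper
      have hv := v.lower_le_upper
      rw [eq_base_of_upper_le_lower (h.trans (hv.trans h')),
        eq_base_of_upper_le_lower (h'.trans (hu.trans h)),
        le_antisymm (h.trans hv) (h'.trans hu)]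

theorem le_iff {u v : F.Eyed} : u ≤ v ↔ u = v ∨ u.upper ≤ v.lower := Iff.rfl

theorem base_le_iff {x : L} {v : F.Eyed} : base x ≤ v ↔ x ≤ v.lower :=
  ⟨by rintro (rfl | h); exacts [le_rfl, h], .inr⟩

theorem le_base_iff {x : L} {v : F.Eyed} : v ≤ base x ↔ v.upper ≤ x :=
  ⟨by rintro (rfl | h); exacts [le_rfl, h], .inr⟩

theorem base_le_base {x y : L} : (base x : F.Eyed) ≤ base y ↔ x ≤ y := base_le_iff

theorem base_lower_le (u : F.Eyed) : base u.lower ≤ u := base_le_iff.2 le_rfl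

theorem le_base_upper (u : F.Eyed) : u ≤ base u.upper := le_base_iff.2 le_rfl

theorem base_bot_le_eye (e : E) : (base (F.bot e) : F.Eyed) ≤ eye e := base_le_iff.2 le_rfl

theorem eye_le_base_top (e : E) : (eye e : F.Eyed) ≤ base (F.top e) := le_base_iff.2 le_rfl

theorem upper_le_lower_of_lt {u v : F.Eyed} (h : u < v) : u.upper ≤ v.lower :=
  (le_iff.1 h.le).resolve_left h.ne

theorem upper_mono {u v : F.Eyed} (h : u ≤ v) : u.upper ≤ v.upper :=
  le_base_iff.1 (h.trans v.le_base_upper)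

theorem lower_mono {u v : F.Eyed} (h : u ≤ v) : u.lower ≤ v.lower :=
  base_le_iff.1 (u.base_lower_le.trans h)

open Classical in
/-- The join of two elements. -/
noncomputable def join (u v : F.Eyed) : F.Eyed :=
  if u ≤ v then v else if v ≤ u then u else base (u.upper ⊔ v.upper)

open Classical in
/-- The meet of two elements. -/
noncomputable def meet (u v : F.Eyed) : F.Eyed :=
  if u ≤ v then u else if v ≤ u then v else base (u.lower ⊓ v.lower)

/-- An upper bound of two incomparable elements differs from both, so its `lower` dominates both
`upper`s; dually for meets. -/
noncomputable instance : Lattice F.Eyed where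
  sup := join
  inf := meet
  le_sup_left u v := by
    unfold join
    split_ifs with h1 h2
    exacts [h1, le_rfl, le_base_iff.2 le_sup_left]
  le_sup_right u v := by
    unfold join
    split_ifs with h1 h2
    exacts [le_rfl, h2, le_base_iff.2 le_sup_right]
  sup_le u v w hu hv := by
    unfold join
    split_ifs with h1 h2
    · exact hv
    · exact hu
    · rcases hu with rfl | hu
      · exact absurd hv h2
      rcases hv with rfl | hv
      · exact absurd (.inr hu) h1
      exact base_le_iff.2 (sup_le hu hv)
  inf_le_left u v := by
    unfold meet
    split_ifs with h1 h2
    exacts [le_rfl, h2, base_le_iff.2 inf_le_left]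
  inf_le_right u v := by
    unfold meet
    split_ifs with h1 h2
    exacts [h1, le_rfl, base_le_iff.2 inf_le_right]
  le_inf u v w hu hv := by
    unfold meet
    split_ifs with h1 h2
    · exact hu
    · exact hv
    · rcases hu with rfl | hu
      · exact absurd hv h1
      rcases hv with rfl | hv
      · exact absurd (.inr hu) h2
      exact le_base_iff.2 (le_inf hu hv)

theorem sup_eq_base {u v : F.Eyed} (h1 : ¬ u ≤ v) (h2 : ¬ v ≤ u) :
    u ⊔ v = base (u.upper ⊔ v.upper) := by
  change join u v = _
  rw [join, if_neg h1, if_neg h2]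

theorem inf_eq_base {u v : F.Eyed} (h1 : ¬ u ≤ v) (h2 : ¬ v ≤ u) :
    u ⊓ v = base (u.lower ⊓ v.lower) := by
  change meet u v = _
  rw [meet, if_neg h1, if_neg h2]

theorem upper_sup (u v : F.Eyed) : (u ⊔ v).upper = u.upper ⊔ v.upper := by
  by_cases h1 : u ≤ v
  · rw [sup_eq_right.2 h1, sup_eq_right.2 (upper_mono h1)]
  by_cases h2 : v ≤ u
  · rw [sup_eq_left.2 h2, sup_eq_left.2 (upper_mono h2)]
  rw [sup_eq_base h1 h2, upper_base]

theorem lower_inf (u v : F.Eyed) : (u ⊓ v).lower = u.lower ⊓ v.lower := by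
  by_cases h1 : u ≤ v
  · rw [inf_eq_left.2 h1, inf_eq_left.2 (lower_mono h1)]
  by_cases h2 : v ≤ u
  · rw [inf_eq_right.2 h2, inf_eq_right.2 (lower_mono h2)]
  rw [inf_eq_base h1 h2, lower_base]

theorem base_sup (x y : L) : (base (x ⊔ y) : F.Eyed) = base x ⊔ base y := by
  refine le_antisymm (base_le_iff.2 (sup_le ?_ ?_))
    (sup_le (base_le_base.2 le_sup_left) (base_le_base.2 le_sup_right))
  exacts [base_le_iff.1 le_sup_left, base_le_iff.1 le_sup_right]

theorem base_inf (x y : L) : (base (x ⊓ y) : F.Eyed) = base x ⊓ base y := by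
  refine le_antisymm
    (le_inf (base_le_base.2 inf_le_left) (base_le_base.2 inf_le_right))
    (le_base_iff.2 (le_inf ?_ ?_))
  exacts [le_base_iff.1 inf_le_left, le_base_iff.1 inf_le_right]

theorem eye_sup_base {e : E} {x : L} (h : ¬ x ≤ F.bot e) :
    eye e ⊔ base x = (base (F.top e ⊔ x) : F.Eyed) := by
  by_cases h' : F.top e ≤ x
  · rw [sup_eq_right.2 h', sup_eq_right.2 (le_base_iff.2 h')]
  · rw [sup_eq_base (fun h => h' (le_base_iff.1 h)) (fun h' => h (base_le_iff.1 h'))]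
    rfl

theorem eye_inf_base {e : E} {x : L} (h : ¬ F.top e ≤ x) :
    eye e ⊓ base x = (base (F.bot e ⊓ x) : F.Eyed) := by
  by_cases h' : x ≤ F.bot e
  · rw [inf_eq_right.2 h', inf_eq_right.2 (base_le_iff.2 h')]
  · rw [inf_eq_base (fun h' => h (le_base_iff.1 h')) (fun h => h' (base_le_iff.1 h))]
    rfl

/-! ### Semimodularity -/

/-- No eye fits inside a covering pair of `L`, since `left` lies strictly between the ends of an
eye. -/
theorem base_covBy_base {x y : L} (h : x ⋖ y) : (base x : F.Eyed) ⋖ base y := by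
  refine ⟨(base_le_base.2 h.le).lt_of_ne fun e => h.ne (base_injective e), fun w h1 h2 => ?_⟩
  have h3 : x ≤ w.lower := upper_le_lower_of_lt h1
  have h4 : w.upper ≤ y := upper_le_lower_of_lt h2
  have h5 := w.lower_le_upper
  have h6 : w.upper ≤ w.lower := by
    rcases h.eq_or_eq h3 (h5.trans h4) with e | e
    · rcases h.eq_or_eq (h3.trans h5) h4 with e' | e'
      · rw [e, e']
      · rcases base_or_eye w with ⟨z, rfl⟩ | ⟨i, rfl⟩
        · exact le_rfl
        · exfalso
          simp only [lower_eye, upper_eye] at e e'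
          have l1 : F.bot i < F.left i := inf_lt_left.2 (F.not_left_le i)
          have l2 : F.left i < F.top i := left_lt_sup.2 (F.not_right_le i)
          rw [e] at l1
          rw [e'] at l2
          exact h.2 l1 l2
    · rw [e]; exact h4
  have hw := eq_base_of_upper_le_lower h6
  rw [hw] at h1 h2
  exact h.2 ((base_le_base.1 h1.le).lt_of_ne fun e => h1.ne (congrArg _ e))
    ((base_le_base.1 h2.le).lt_of_ne fun e => h2.ne (congrArg _ e))

theorem eye_covBy_top (e : E) : (eye e : F.Eyed) ⋖ base (F.top e) := by
  refine ⟨(eye_le_base_top e).lt_of_ne (base_ne_eye _ _).symm, fun w h1 h2 => ?_⟩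
  exact h2.not_ge (base_le_iff.2 (upper_le_lower_of_lt h1))

theorem eq_of_eye_covBy {e : E} {w : F.Eyed} (h : eye e ⋖ w) : w = base (F.top e) := by
  refine (h.eq_or_eq (eye_covBy_top e).le
    (base_le_iff.2 (upper_le_lower_of_lt h.lt))).resolve_left (base_ne_eye _ _) |>.symm

theorem covBy_of_base_covBy_base {x y : L} (h : (base x : F.Eyed) ⋖ base y) : x ⋖ y := by
  refine ⟨(base_le_base.1 h.le).lt_of_ne fun e => h.ne (congrArg _ e), fun w h1 h2 => ?_⟩
  exact h.2 ((base_le_base.2 h1.le).lt_of_ne fun e => h1.ne (base_injective e))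
    ((base_le_base.2 h2.le).lt_of_ne fun e => h2.ne (base_injective e))

theorem eq_of_base_covBy_eye {x : L} {e : E} (h : (base x : F.Eyed) ⋖ eye e) : x = F.bot e :=
  base_injective ((h.eq_or_eq (base_le_base.2 (upper_le_lower_of_lt h.lt))
    (base_bot_le_eye e)).resolve_right (base_ne_eye _ _)).symm

/-- An eye has a single cover, and distinct eyes have distinct bottoms. The only new pair of covers
is an eye and an element `z` of `L` above its bottom; by `htop` their join is the top, which covers
both. -/
theorem isUpperModularLattice [Finite L] [Finite E]
    (hL : ∀ ⦃c a b : L⦄, c ⋖ a → c ⋖ b → a ≠ b → a ⋖ a ⊔ b)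
    (hbot : Function.Injective F.bot) (htop : ∀ e z, F.bot e ⋖ z → z ⋖ F.top e) :
    IsUpperModularLattice F.Eyed := by
  apply isUpperModularLattice_of_covBy
  intro c a b hca hcb hne
  rcases base_or_eye c with ⟨c, rfl⟩ | ⟨e, rfl⟩
  · rcases base_or_eye a with ⟨a, rfl⟩ | ⟨i, rfl⟩ <;>
      rcases base_or_eye b with ⟨b, rfl⟩ | ⟨j, rfl⟩
    · rw [← base_sup]
      exact base_covBy_base (hL (covBy_of_base_covBy_base hca) (covBy_of_base_covBy_base hcb)
        fun e => hne (congrArg _ e))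
    · obtain rfl := eq_of_base_covBy_eye hcb
      have hca' := covBy_of_base_covBy_base hca
      have ha := htop j a hca'
      rw [sup_comm, eye_sup_base hca'.lt.not_ge, sup_eq_left.2 ha.le]
      exact base_covBy_base ha
    · obtain rfl := eq_of_base_covBy_eye hca
      have hcb' := covBy_of_base_covBy_base hcb
      have hb := htop i b hcb'
      rw [eye_sup_base hcb'.lt.not_ge, sup_eq_left.2 hb.le]
      exact eye_covBy_top i
    · refine absurd (congrArg eye (hbot ?_)) hne
      rw [← eq_of_base_covBy_eye hca, ← eq_of_base_covBy_eye hcb]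
  · exact absurd ((eq_of_eye_covBy hca).trans (eq_of_eye_covBy hcb).symm) hne

/-! ### Congruences -/

/-- The congruence of `L` induced by a congruence of the lattice with eyes. -/
def restrict (θ : LatticeCon F.Eyed) : LatticeCon L where
  r x y := θ.r (base x) (base y)
  iseqv := ⟨fun _ => θ.iseqv.refl _, θ.iseqv.symm, θ.iseqv.trans⟩
  inf h1 h2 := by
    simp only [base_inf]
    exact θ.inf h1 h2
  sup h1 h2 := by
    simp only [base_sup]
    exact θ.sup h1 h2

/-- The extension of a relation on `L`: the new element of an eye is related to other elements
iff the ends of the eye are related. -/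
def ExtendRel (ψ : LatticeCon L) (u v : F.Eyed) : Prop :=
  u = v ∨ ψ.r u.lower u.upper ∧ ψ.r v.lower v.upper ∧ ψ.r u.upper v.upper

variable (F) in
/-- A congruence of `L` is compatible with the eyes if it collapses an eye as soon as it
identifies one end of the eye with an element beyond it. -/
structure Compatible (ψ : LatticeCon L) : Prop where
  up : ∀ e z, F.bot e < z → ψ.r (F.bot e) z → ψ.r (F.bot e) (F.top e)
  down : ∀ e z, z < F.top e → ψ.r z (F.top e) → ψ.r (F.bot e) (F.top e)

section Extend

variable {ψ : LatticeCon L}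

/-- Being collapsed is automatic on `L`, where `lower` and `upper` agree, and a join of incomparable
elements lies in `L`. -/
theorem collapsed_sup {u : F.Eyed} (w : F.Eyed) (hu : ψ.r u.lower u.upper) (h : ¬ u ≤ w) :
    ψ.r (u ⊔ w).lower (u ⊔ w).upper := by
  by_cases h' : w ≤ u
  · rwa [sup_eq_left.2 h']
  · rw [sup_eq_base h h']
    exact ψ.iseqv.refl _

theorem collapsed_inf {u : F.Eyed} (w : F.Eyed) (hu : ψ.r u.lower u.upper) (h : ¬ w ≤ u) :
    ψ.r (u ⊓ w).lower (u ⊓ w).upper := by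
  by_cases h' : u ≤ w
  · rwa [inf_eq_left.2 h']
  · rw [inf_eq_base h' h]
    exact ψ.iseqv.refl _

/-- If `w` is an eye above `u ≠ w` but not above `v`, joining with its bottom identifies the bottom
with an element strictly beyond it, so compatibility collapses `w`. -/
theorem Compatible.collapsed_of_le (hψ : Compatible F ψ) {u v w : F.Eyed}
    (hu : ψ.r u.lower u.upper) (huv : ψ.r u.upper v.upper) (h : u ≤ w) (h' : ¬ v ≤ w) :
    ψ.r w.lower w.upper := by
  rcases le_iff.1 h with rfl | hle
  · exact hu
  rcases base_or_eye w with ⟨x, rfl⟩ | ⟨e, rfl⟩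
  · exact ψ.iseqv.refl _
  have hv : ¬ v.upper ≤ F.bot e := fun h => h' (.inr h)
  have := ψ.sup (ψ.iseqv.refl (F.bot e)) huv
  rw [sup_eq_left.2 (show u.upper ≤ F.bot e from hle)] at this
  exact hψ.up e _ (left_lt_sup.2 hv) this

theorem Compatible.collapsed_of_ge (hψ : Compatible F ψ) {u v w : F.Eyed}
    (hu : ψ.r u.lower u.upper) (huv : ψ.r u.lower v.lower) (h : w ≤ u) (h' : ¬ w ≤ v) :
    ψ.r w.lower w.upper := by
  rcases le_iff.1 h with rfl | hle
  · exact hu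
  rcases base_or_eye w with ⟨x, rfl⟩ | ⟨e, rfl⟩
  · exact ψ.iseqv.refl _
  have hv : ¬ F.top e ≤ v.lower := fun h => h' (.inr h)
  have := ψ.inf (ψ.iseqv.refl (F.top e)) huv
  rw [inf_eq_left.2 (show F.top e ≤ u.lower from hle)] at this
  exact hψ.down e _ (inf_lt_left.2 hv) (ψ.iseqv.symm this)

theorem ExtendRel.symm {u v : F.Eyed} : ExtendRel ψ u v → ExtendRel ψ v u := by
  rintro (rfl | ⟨h1, h2, h3⟩)
  exacts [.inl rfl, .inr ⟨h2, h1, ψ.iseqv.symm h3⟩]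

theorem ExtendRel.trans {u v w : F.Eyed} :
    ExtendRel ψ u v → ExtendRel ψ v w → ExtendRel ψ u w := by
  rintro (rfl | ⟨h1, h2, h3⟩) (rfl | ⟨h4, h5, h6⟩)
  exacts [.inl rfl, .inr ⟨h4, h5, h6⟩, .inr ⟨h1, h2, h3⟩, .inr ⟨h1, h5, ψ.iseqv.trans h3 h6⟩]

theorem Compatible.extendRel_sup (hψ : Compatible F ψ) {u v : F.Eyed} (w : F.Eyed)
    (h : ExtendRel ψ u v) : ExtendRel ψ (u ⊔ w) (v ⊔ w) := by
  rcases h with rfl | ⟨hu, hv, huv⟩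
  · exact .inl rfl
  by_cases h1 : u ≤ w <;> by_cases h2 : v ≤ w
  · exact .inl ((sup_eq_right.2 h1).trans (sup_eq_right.2 h2).symm)
  all_goals
    refine .inr ⟨?_, ?_, ?_⟩
    rotate_left 2
    · rw [upper_sup, upper_sup]
      exact ψ.sup huv (ψ.iseqv.refl _)
  · rw [sup_eq_right.2 h1]
    exact hψ.collapsed_of_le hu huv h1 h2
  · exact collapsed_sup w hv h2
  · exact collapsed_sup w hu h1
  · rw [sup_eq_right.2 h2]
    exact hψ.collapsed_of_le hv (ψ.iseqv.symm huv) h2 h1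
  · exact collapsed_sup w hu h1
  · exact collapsed_sup w hv h2

theorem Compatible.extendRel_inf (hψ : Compatible F ψ) {u v : F.Eyed} (w : F.Eyed)
    (h : ExtendRel ψ u v) : ExtendRel ψ (u ⊓ w) (v ⊓ w) := by
  rcases h with rfl | ⟨hu, hv, huv⟩
  · exact .inl rfl
  have hlow : ψ.r u.lower v.lower := ψ.iseqv.trans hu (ψ.iseqv.trans huv (ψ.iseqv.symm hv))
  by_cases h1 : w ≤ u <;> by_cases h2 : w ≤ v
  · exact .inl ((inf_eq_right.2 h1).trans (inf_eq_right.2 h2).symm)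
  all_goals
    suffices H : ψ.r (u ⊓ w).lower (u ⊓ w).upper ∧ ψ.r (v ⊓ w).lower (v ⊓ w).upper by
      refine .inr ⟨H.1, H.2, ψ.iseqv.trans (ψ.iseqv.symm H.1) (ψ.iseqv.trans ?_ H.2)⟩
      rw [lower_inf, lower_inf]
      exact ψ.inf hlow (ψ.iseqv.refl _)
    refine ⟨?_, ?_⟩
  · rw [inf_eq_right.2 h1]
    exact hψ.collapsed_of_ge hu hlow h1 h2
  · exact collapsed_inf w hv h2
  · exact collapsed_inf w hu h1
  · rw [inf_eq_right.2 h2]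
    exact hψ.collapsed_of_ge hv (ψ.iseqv.symm hlow) h2 h1
  · exact collapsed_inf w hu h1
  · exact collapsed_inf w hv h2

/-- The extension of a congruence that is compatible with the eyes. -/
def extend (hψ : Compatible F ψ) : LatticeCon F.Eyed where
  r := ExtendRel ψ
  iseqv := ⟨fun _ => .inl rfl, ExtendRel.symm, ExtendRel.trans⟩
  inf {w x y z} h1 h2 := (hψ.extendRel_inf y h1).trans (by
    rw [inf_comm x, inf_comm x]; exact hψ.extendRel_inf x h2)
  sup {w x y z} h1 h2 := (hψ.extendRel_sup y h1).trans (by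
    rw [sup_comm x, sup_comm x]; exact hψ.extendRel_sup x h2)

theorem extend_base_iff (hψ : Compatible F ψ) {x y : L} :
    (extend hψ).r (base x : F.Eyed) (base y) ↔ ψ.r x y := by
  constructor
  · rintro (h | ⟨-, -, h⟩)
    · rw [base_injective h]
    · exact h
  · exact fun h => .inr ⟨ψ.iseqv.refl _, ψ.iseqv.refl _, h⟩

end Extend

section Determined

variable (θ : LatticeCon F.Eyed) {θ' : LatticeCon F.Eyed} {e : E}

/-- Bottom, left, eye, right and top form an `M₃`: meeting with left and right collapses both lower
edges, whose join is the whole interval. -/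
theorem collapsed_of_eye_top (h : θ.r (eye e) (base (F.top e))) :
    θ.r (base (F.bot e)) (base (F.top e)) := by
  have h1 := θ.inf h (θ.iseqv.refl (base (F.left e)))
  have h2 := θ.inf h (θ.iseqv.refl (base (F.right e)))
  rw [eye_inf_base (left_lt_sup.2 (F.not_right_le e)).not_ge, ← base_inf,
    inf_eq_left.2 (F.bot_le_left e),
    inf_eq_right.2 (F.left_le_top e)] at h1
  rw [eye_inf_base (right_lt_sup.2 (F.not_left_le e)).not_ge, ← base_inf,
    inf_eq_left.2 (F.bot_le_right e),
    inf_eq_right.2 (F.right_le_top e)] at h2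
  have := θ.sup h1 h2
  rwa [← base_sup, ← base_sup, sup_idem] at this

theorem collapsed_of_bot_eye (h : θ.r (base (F.bot e)) (eye e)) :
    θ.r (base (F.bot e)) (base (F.top e)) := by
  have h1 := θ.sup (θ.iseqv.symm h) (θ.iseqv.refl (base (F.left e)))
  have h2 := θ.sup (θ.iseqv.symm h) (θ.iseqv.refl (base (F.right e)))
  rw [eye_sup_base (inf_lt_left.2 (F.not_left_le e)).not_ge, ← base_sup,
    sup_eq_right.2 (F.bot_le_left e),
    sup_eq_left.2 (F.left_le_top e)] at h1
  rw [eye_sup_base (inf_lt_right.2 (F.not_right_le e)).not_ge, ← base_sup,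
    sup_eq_right.2 (F.bot_le_right e),
    sup_eq_left.2 (F.right_le_top e)] at h2
  have := θ.inf h1 h2
  rw [← base_inf, ← base_inf, inf_idem] at this
  exact θ.iseqv.symm this

theorem collapsed_of_bot_left (h : θ.r (base (F.bot e)) (base (F.left e))) :
    θ.r (base (F.bot e)) (base (F.top e)) := by
  have h1 := θ.sup (θ.iseqv.refl (eye e)) h
  rw [sup_eq_left.2 (base_bot_le_eye e),
    eye_sup_base (inf_lt_left.2 (F.not_left_le e)).not_ge,
    sup_eq_left.2 (F.left_le_top e)] at h1
  exact collapsed_of_eye_top θ h1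

theorem collapsed_of_bot_right (h : θ.r (base (F.bot e)) (base (F.right e))) :
    θ.r (base (F.bot e)) (base (F.top e)) := by
  have h1 := θ.sup (θ.iseqv.refl (eye e)) h
  rw [sup_eq_left.2 (base_bot_le_eye e),
    eye_sup_base (inf_lt_right.2 (F.not_right_le e)).not_ge,
    sup_eq_left.2 (F.right_le_top e)] at h1
  exact collapsed_of_eye_top θ h1

/-- The two lower edges of an eye generate the same congruence. -/
theorem bot_left_iff_bot_right :
    θ.r (base (F.bot e)) (base (F.left e)) ↔ θ.r (base (F.bot e)) (base (F.right e)) := by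
  constructor <;> intro h
  · have h1 := θ.inf (collapsed_of_bot_left θ h) (θ.iseqv.refl (base (F.right e)))
    rwa [← base_inf, ← base_inf, inf_eq_left.2 (F.bot_le_right e),
      inf_eq_right.2 (F.right_le_top e)] at h1
  · have h1 := θ.inf (collapsed_of_bot_right θ h) (θ.iseqv.refl (base (F.left e)))
    rwa [← base_inf, ← base_inf, inf_eq_left.2 (F.bot_le_left e),
      inf_eq_right.2 (F.left_le_top e)] at h1

variable {θ}

/-- An eye congruent to another element is congruent to one of its ends: join with the bottom if
that element is below, otherwise join with the eye and cut at the top. -/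
theorem collapsed_of_rel {u v : F.Eyed} (h : θ.r u v) (hne : u ≠ v) :
    θ.r (base u.lower) (base u.upper) := by
  rcases base_or_eye u with ⟨x, rfl⟩ | ⟨e, rfl⟩
  · exact θ.iseqv.refl _
  by_cases hle : v ≤ eye e
  · apply collapsed_of_bot_eye
    have h1 := θ.sup h (θ.iseqv.refl (base (F.bot e)))
    have hv : v.upper ≤ F.bot e := upper_le_lower_of_lt (hle.lt_of_ne hne.symm)
    rw [sup_eq_left.2 (base_bot_le_eye e), sup_eq_right.2 (le_base_iff.2 hv)] at h1
    exact θ.iseqv.symm h1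
  · apply collapsed_of_eye_top
    have h1 := θ.inf (θ.sup (θ.iseqv.refl (eye e)) h) (θ.iseqv.refl (base (F.top e)))
    have hv : F.top e ≤ (eye e ⊔ v).lower := upper_le_lower_of_lt (left_lt_sup.2 hle)
    rwa [sup_idem, inf_eq_left.2 (eye_le_base_top e),
      inf_eq_right.2 (base_le_iff.2 hv)] at h1

theorem rel_upper_of_collapsed {u : F.Eyed} (h : θ.r (base u.lower) (base u.upper)) :
    θ.r u (base u.upper) := by
  have h1 := θ.sup (θ.iseqv.refl u) h
  rwa [sup_eq_left.2 u.base_lower_le, sup_eq_right.2 u.le_base_upper] at h1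

theorem rel_iff_extendRel_restrict {u v : F.Eyed} :
    θ.r u v ↔ ExtendRel (restrict θ) u v := by
  constructor
  · intro h
    by_cases hne : u = v
    · exact .inl hne
    have hu := collapsed_of_rel h hne
    have hv := collapsed_of_rel (θ.iseqv.symm h) (Ne.symm hne)
    exact .inr ⟨hu, hv, θ.iseqv.trans (θ.iseqv.symm (rel_upper_of_collapsed hu))
      (θ.iseqv.trans h (rel_upper_of_collapsed hv))⟩
  · rintro (rfl | ⟨hu, hv, h⟩)
    · exact θ.iseqv.refl _
    · exact θ.iseqv.trans (rel_upper_of_collapsed hu)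
        (θ.iseqv.trans h (θ.iseqv.symm (rel_upper_of_collapsed hv)))

/-- A congruence of the lattice with eyes is determined by its restriction. -/
theorem le_of_restrict_le (h : restrict θ ≤ restrict θ') : θ ≤ θ' := by
  intro u v huv
  rw [rel_iff_extendRel_restrict] at huv ⊢
  rcases huv with rfl | ⟨h1, h2, h3⟩
  exacts [.inl rfl, .inr ⟨h h1, h h2, h h3⟩]

end Determined

end Eyed

end EyeFamily

/-! ### The grid with forks on the diagonal. -/

/-- A finite chain `0 < 1 < ⋯ < N` with isolated inner fork points. -/
structure ForkedChain where
  N : ℕ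
  Fork : ℕ → Prop
  pos : ∀ {x}, Fork x → 0 < x
  lt : ∀ {x}, Fork x → x < N
  isolated : ∀ {x}, Fork x → ¬ Fork (x + 1)

namespace ForkedChain

variable (C : ForkedChain)

/-- The points of the square of the chain that remain when a fork is inserted on the diagonal
at each fork point. -/
def Mem (a b : ℕ) : Prop :=
  a ≤ C.N ∧ b ≤ C.N ∧ (C.Fork a → b ≤ a) ∧ (C.Fork b → a ≤ b)

/-- The grid with forks on the diagonal. -/
@[ext]
structure Grid where
  x : ℕ
  y : ℕ
  mem : C.Mem x y

variable {C} in
-- The grid is thus a meet-subsemilattice of the square; joins are obtained by rounding the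
-- coordinatewise maximum up.
theorem Mem.inf {a b a' b' : ℕ} (h : C.Mem a b) (h' : C.Mem a' b') :
    C.Mem (min a a') (min b b') := by
  obtain ⟨h1, h2, h3, h4⟩ := h
  obtain ⟨h1', h2', h3', h4'⟩ := h'
  refine ⟨by omega, by omega, fun h => ?_, fun h => ?_⟩
  · rcases min_choice a a' with e | e <;> rw [e] at h ⊢
    · have := h3 h; omega
    · have := h3' h; omega
  · rcases min_choice b b' with e | e <;> rw [e] at h ⊢
    · have := h4 h; omega
    · have := h4' h; omega

open Classical in
/-- The first coordinate of the smallest element of the grid above `(a, b)`. -/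
noncomputable def bump (a b : ℕ) : ℕ := if C.Fork a ∧ a < b then a + 1 else a

theorem bump_cases (a b : ℕ) :
    C.Fork a ∧ a < b ∧ C.bump a b = a + 1 ∨ (C.Fork a → b ≤ a) ∧ C.bump a b = a := by
  unfold bump
  split_ifs with h
  · exact .inl ⟨h.1, h.2, rfl⟩
  · exact .inr ⟨fun h' => by by_contra h''; exact h ⟨h', by omega⟩, rfl⟩

/-- At most one coordinate is bumped, and once is enough: the point after a fork is not a fork and
is still at most `N`. -/
theorem mem_bump {a b : ℕ} (ha : a ≤ C.N) (hb : b ≤ C.N) :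
    C.Mem (C.bump a b) (C.bump b a) := by
  rcases C.bump_cases a b with ⟨h1, h2, h3⟩ | ⟨h1, h3⟩ <;>
    rcases C.bump_cases b a with ⟨k1, k2, k3⟩ | ⟨k1, k3⟩ <;> rw [h3, k3]
  · omega
  · exact ⟨C.lt h1, hb, fun h => absurd h (C.isolated h1), fun h => h2⟩
  · exact ⟨ha, C.lt k1, fun h => k2, fun h => absurd h (C.isolated k1)⟩
  · exact ⟨ha, hb, h1, k1⟩

namespace Grid

variable {C}

instance : PartialOrder C.Grid :=
  PartialOrder.lift (fun p => (p.x, p.y)) fun _ _ h =>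
    Grid.ext (congrArg Prod.fst h) (congrArg Prod.snd h)

theorem le_iff {p q : C.Grid} : p ≤ q ↔ p.x ≤ q.x ∧ p.y ≤ q.y := Iff.rfl

variable (C) in
/-- The smallest element of the grid above the point `(a, b)` truncated to the square. -/
noncomputable def pt (a b : ℕ) : C.Grid :=
  ⟨_, _, C.mem_bump (min_le_right a C.N) (min_le_right b C.N)⟩

theorem pt_le_iff' {a b : ℕ} {p : C.Grid} :
    pt C a b ≤ p ↔ min a C.N ≤ p.x ∧ min b C.N ≤ p.y := by
  rw [le_iff]
  change C.bump _ _ ≤ _ ∧ C.bump _ _ ≤ _ ↔ _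
  obtain ⟨h1, h2, h3, h4⟩ := p.mem
  set a' := min a C.N
  set b' := min b C.N
  constructor
  · intro h
    rcases C.bump_cases a' b' with k | k <;> rcases C.bump_cases b' a' with k' | k' <;> omega
  · rintro ⟨ha, hb⟩
    constructor
    · rcases C.bump_cases a' b' with ⟨k1, k2, k3⟩ | ⟨k1, k3⟩ <;> rw [k3]
      · rcases ha.eq_or_lt with e | e
        · rw [← e] at h3
          have := h3 k1
          omega
        · exact e
      · exact ha
    · rcases C.bump_cases b' a' with ⟨k1, k2, k3⟩ | ⟨k1, k3⟩ <;> rw [k3]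
      · rcases hb.eq_or_lt with e | e
        · rw [← e] at h4
          have := h4 k1
          omega
        · exact e
      · exact hb

theorem pt_le_iff {a b : ℕ} (ha : a ≤ C.N) (hb : b ≤ C.N) {p : C.Grid} :
    pt C a b ≤ p ↔ a ≤ p.x ∧ b ≤ p.y := by
  rw [pt_le_iff', min_eq_left ha, min_eq_left hb]

noncomputable instance : Lattice C.Grid where
  inf p q := ⟨_, _, p.mem.inf q.mem⟩
  sup p q := pt C (max p.x q.x) (max p.y q.y)
  inf_le_left p q := ⟨min_le_left _ _, min_le_left _ _⟩
  inf_le_right p q := ⟨min_le_right _ _, min_le_right _ _⟩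
  le_inf p q r h1 h2 := ⟨le_min h1.1 h2.1, le_min h1.2 h2.2⟩
  le_sup_left p q := by
    have h := (pt_le_iff (max_le p.mem.1 q.mem.1) (max_le p.mem.2.1 q.mem.2.1)).1 le_rfl
    exact ⟨(le_max_left _ _).trans h.1, (le_max_left _ _).trans h.2⟩
  le_sup_right p q := by
    have h := (pt_le_iff (max_le p.mem.1 q.mem.1) (max_le p.mem.2.1 q.mem.2.1)).1 le_rfl
    exact ⟨(le_max_right _ _).trans h.1, (le_max_right _ _).trans h.2⟩
  sup_le p q r h1 h2 :=
    (pt_le_iff (max_le p.mem.1 q.mem.1) (max_le p.mem.2.1 q.mem.2.1)).2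
      ⟨max_le h1.1 h2.1, max_le h1.2 h2.2⟩

instance : Finite C.Grid := by
  refine Finite.of_injective
    (fun p : C.Grid => ((⟨p.x, Nat.lt_succ_of_le p.mem.1⟩ : Fin (C.N + 1)),
      (⟨p.y, Nat.lt_succ_of_le p.mem.2.1⟩ : Fin (C.N + 1)))) fun p q h => ?_
  simp only [Prod.mk.injEq, Fin.mk.injEq] at h
  exact Grid.ext h.1 h.2

theorem pt_eq {a b : ℕ} (h : C.Mem a b) : pt C a b = ⟨a, b, h⟩ := by
  refine le_antisymm ((pt_le_iff h.1 h.2.1).2 ⟨le_rfl, le_rfl⟩) ?_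
  exact (pt_le_iff h.1 h.2.1).1 le_rfl

theorem pt_coords (p : C.Grid) : pt C p.x p.y = p := pt_eq p.mem

theorem pt_sup (a b a' b' : ℕ) : pt C a b ⊔ pt C a' b' = pt C (max a a') (max b b') := by
  refine eq_of_forall_ge_iff fun p => ?_
  rw [sup_le_iff, pt_le_iff', pt_le_iff', pt_le_iff']
  omega

/-- Membership is needed, unlike in `pt_sup`: for a fork `k`, both `(k, k + 1)` and `(k + 1, k)`
round up to `(k + 1, k + 1)`, but their minimum is `(k, k)`. -/
theorem pt_inf {a b a' b' : ℕ} (h : C.Mem a b) (h' : C.Mem a' b') :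
    pt C a b ⊓ pt C a' b' = pt C (min a a') (min b b') := by
  rw [pt_eq h, pt_eq h', pt_eq (h.inf h')]
  rfl

/-! ### Covers -/

theorem covBy_pt_succ_right {a b : ℕ} (ha : a ≤ C.N) (hb : b + 1 ≤ C.N)
    (hne : pt C a b ≠ pt C a (b + 1)) : pt C a b ⋖ pt C a (b + 1) := by
  have hle : pt C a (b + 1) ≤ pt C a (b + 1) := le_rfl
  rw [pt_le_iff ha hb] at hle
  refine ⟨((pt_le_iff ha (by omega)).2 ⟨hle.1, by omega⟩).lt_of_ne hne, fun w h1 h2 => ?_⟩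
  have l1 := (pt_le_iff ha (by omega)).1 h1.le
  have hy : w.y = b := by
    by_contra h
    exact h2.not_ge ((pt_le_iff ha hb).2 ⟨l1.1, by omega⟩)
  have l2 := (le_iff.1 h2.le).1
  change _ ≤ C.bump _ _ at l2
  rw [min_eq_left ha, min_eq_left hb] at l2
  have hnle : ¬ (w.x ≤ (pt C a b).x ∧ w.y ≤ (pt C a b).y) := fun h => h1.not_ge h
  have l3 := (pt_le_iff ha (by omega : b ≤ C.N)).1 (le_refl (pt C a b))
  have l4 : (pt C a b).x = C.bump a b := by
    change C.bump _ _ = _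
    rw [min_eq_left ha, min_eq_left (by omega : b ≤ C.N)]
  obtain ⟨-, -, -, h4⟩ := w.mem
  rw [hy] at h4
  rcases C.bump_cases a (b + 1) with ⟨k1, k2, k3⟩ | ⟨k1, k3⟩
  · rcases C.bump_cases a b with ⟨j1, j2, j3⟩ | ⟨j1, j3⟩
    · omega
    -- The first coordinate is newly bumped only if `a = b` is a fork; but then no point at height
    -- `b` has first coordinate beyond `a`.
    · have := j1 k1
      obtain rfl : a = b := by omega
      have := h4 k1
      omega
  · omega

theorem covBy_pt_succ_left {a b : ℕ} (ha : a + 1 ≤ C.N) (hb : b ≤ C.N)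
    (hne : pt C a b ≠ pt C (a + 1) b) : pt C a b ⋖ pt C (a + 1) b := by
  have hle : pt C (a + 1) b ≤ pt C (a + 1) b := le_rfl
  rw [pt_le_iff ha hb] at hle
  refine ⟨((pt_le_iff (by omega) hb).2 ⟨by omega, hle.2⟩).lt_of_ne hne, fun w h1 h2 => ?_⟩
  have l1 := (pt_le_iff (by omega) hb).1 h1.le
  have hx : w.x = a := by
    by_contra h
    exact h2.not_ge ((pt_le_iff ha hb).2 ⟨by omega, l1.2⟩)
  have l2 := (le_iff.1 h2.le).2
  change _ ≤ C.bump _ _ at l2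
  rw [min_eq_left ha, min_eq_left hb] at l2
  have hnle : ¬ (w.x ≤ (pt C a b).x ∧ w.y ≤ (pt C a b).y) := fun h => h1.not_ge h
  have l3 := (pt_le_iff (by omega : a ≤ C.N) hb).1 (le_refl (pt C a b))
  have l4 : (pt C a b).y = C.bump b a := by
    change C.bump _ _ = _
    rw [min_eq_left (by omega : a ≤ C.N), min_eq_left hb]
  obtain ⟨-, -, h4, -⟩ := w.mem
  rw [hx] at h4
  rcases C.bump_cases b (a + 1) with ⟨k1, k2, k3⟩ | ⟨k1, k3⟩
  · rcases C.bump_cases b a with ⟨j1, j2, j3⟩ | ⟨j1, j3⟩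
    · omega
    · have := j1 k1
      obtain rfl : a = b := by omega
      have := h4 k1
      omega
  · omega

theorem eq_pt_of_covBy {a b : ℕ} (h : C.Mem a b) {z : C.Grid} (hz : pt C a b ⋖ z) :
    (a + 1 ≤ C.N ∧ z = pt C (a + 1) b) ∨ (b + 1 ≤ C.N ∧ z = pt C a (b + 1)) := by
  have l := (pt_le_iff h.1 h.2.1).1 hz.le
  have hnle : ¬ (z.x ≤ a ∧ z.y ≤ b) := by
    intro h'
    refine hz.lt.not_ge ?_
    rw [pt_eq h]
    exact h'
  obtain ⟨h1, h2, -, -⟩ := z.mem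
  by_cases hx : a + 1 ≤ z.x
  · refine .inl ⟨by omega, ((hz.eq_or_eq ?_ ?_).resolve_left ?_).symm⟩
    · exact (pt_le_iff h.1 h.2.1).2
        ((pt_le_iff (by omega) h.2.1).1 (le_refl (pt C (a + 1) b)) |>.imp_left (by omega))
    · exact (pt_le_iff (by omega) h.2.1).2 ⟨hx, l.2⟩
    · intro e
      have := ((pt_le_iff (by omega) h.2.1).1 e.le).1
      rw [pt_eq h] at this
      simp at this
  · have hy : b + 1 ≤ z.y := by omega
    refine .inr ⟨by omega, ((hz.eq_or_eq ?_ ?_).resolve_left ?_).symm⟩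
    · exact (pt_le_iff h.1 h.2.1).2
        ((pt_le_iff h.1 (by omega)).1 (le_refl (pt C a (b + 1))) |>.imp_right (by omega))
    · exact (pt_le_iff h.1 (by omega)).2 ⟨l.1, hy⟩
    · intro e
      have := ((pt_le_iff h.1 (by omega)).1 e.le).2
      rw [pt_eq h] at this
      simp at this

/-- Distinct covers of `c` are its unit steps in the two directions, and their join is a further
unit step from either. -/
theorem covBy_sup_of_covBy ⦃c a b : C.Grid⦄ (ha : c ⋖ a) (hb : c ⋖ b) (hne : a ≠ b) :
    a ⋖ a ⊔ b := by
  have hneq : a ≠ a ⊔ b := fun e =>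
    hne ((ha.eq_or_eq hb.le (sup_eq_left.1 e.symm)).resolve_left hb.lt.ne').symm
  rw [← pt_coords c] at ha hb
  have hcx := c.mem.1
  have hcy := c.mem.2.1
  rcases eq_pt_of_covBy c.mem ha with ⟨h1, rfl⟩ | ⟨h1, rfl⟩ <;>
    rcases eq_pt_of_covBy c.mem hb with ⟨h2, rfl⟩ | ⟨h2, rfl⟩
  · exact absurd rfl hne
  · have e : pt C (c.x + 1) c.y ⊔ pt C c.x (c.y + 1) = pt C (c.x + 1) (c.y + 1) := by
      rw [pt_sup]; congr 1 <;> omega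
    rw [e] at hneq ⊢
    exact covBy_pt_succ_right h1 h2 hneq
  · have e : pt C c.x (c.y + 1) ⊔ pt C (c.x + 1) c.y = pt C (c.x + 1) (c.y + 1) := by
      rw [pt_sup]; congr 1 <;> omega
    rw [e] at hneq ⊢
    exact covBy_pt_succ_left h2 h1 hneq
  · exact absurd rfl hne

end Grid

end ForkedChain

/-! ### The lattice of a coloured chain, its semimodularity and planarity. -/

/-- A chain with forks whose steps `x → x + 1` are coloured by the elements of `P`. The first `n`
steps carry all colours; the others come in pairs around a fork point and realize the order. -/
structure ColoredChain (P : Type*) [Preorder P] extends ForkedChain where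
  n : ℕ
  color : ℕ → P
  n_le : n ≤ N
  lt_of_fork : ∀ {x}, Fork x → n < x
  fork_or : ∀ {x}, n ≤ x → x < N → Fork (x + 1) ∨ Fork x
  color_succ_le : ∀ {x}, Fork (x + 1) → color (x + 1) ≤ color x
  exists_color : ∀ p, ∃ x < n, color x = p
  exists_fork : ∀ {p q}, p ≤ q → ∃ x, Fork (x + 1) ∧ color x = q ∧ color (x + 1) = p

namespace ColoredChain

open ForkedChain ForkedChain.Grid EyeFamily EyeFamily.Eyed

variable {P : Type*} [Preorder P] (C : ColoredChain P)

/-- The cells of the grid that get an eye, given by their bottoms. -/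
def IsEye (e : ℕ × ℕ) : Prop :=
  e.1 < C.N ∧ e.2 < C.N ∧ C.color e.1 = C.color e.2 ∧
    (e.2 < C.n ∨ e.1 = e.2 ∧ C.Fork (e.1 + 1))

variable {C}

/-- All corners of an eye cell survive: they have second coordinate at most `n`, before all forks,
or the cell is diagonal with top at a fork, whose deletions start only beyond it. -/
theorem IsEye.mem {e : ℕ × ℕ} (h : C.IsEye e) {a b : ℕ} (ha : a = e.1 ∨ a = e.1 + 1)
    (hb : b = e.2 ∨ b = e.2 + 1) : C.Mem a b := by
  obtain ⟨h1, h2, -, h3⟩ := h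
  refine ⟨by omega, by omega, fun hf => ?_, fun hf => ?_⟩
  all_goals
    rcases h3 with h3 | ⟨h3, h4⟩
    · have := C.lt_of_fork hf
      omega
    by_contra hlt
  · obtain rfl : a = e.1 := by omega
    exact C.isolated hf h4
  · obtain rfl : b = e.1 := by omega
    exact C.isolated hf h4

variable (C) in
/-- The eyes of the grid. -/
noncomputable def eyes : EyeFamily C.Grid {e : ℕ × ℕ // C.IsEye e} where
  left e := pt C.toForkedChain e.1.1 (e.1.2 + 1)
  right e := pt C.toForkedChain (e.1.1 + 1) e.1.2
  not_left_le e h := by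
    rw [pt_eq (e.2.mem (.inl rfl) (.inr rfl)), pt_eq (e.2.mem (.inr rfl) (.inl rfl))] at h
    have := (Grid.le_iff.1 h).2
    simp at this
  not_right_le e h := by
    rw [pt_eq (e.2.mem (.inl rfl) (.inr rfl)), pt_eq (e.2.mem (.inr rfl) (.inl rfl))] at h
    have := (Grid.le_iff.1 h).1
    simp at this

theorem eyes_bot (e : {e : ℕ × ℕ // C.IsEye e}) :
    C.eyes.bot e = ⟨e.1.1, e.1.2, e.2.mem (.inl rfl) (.inl rfl)⟩ := by
  rw [← pt_eq]
  refine (pt_inf (e.2.mem (.inl rfl) (.inr rfl)) (e.2.mem (.inr rfl) (.inl rfl))).trans ?_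
  congr 1 <;> omega

theorem eyes_top (e : {e : ℕ × ℕ // C.IsEye e}) :
    C.eyes.top e = ⟨e.1.1 + 1, e.1.2 + 1, e.2.mem (.inr rfl) (.inr rfl)⟩ := by
  rw [← pt_eq]
  refine (pt_sup _ _ _ _).trans ?_
  congr 1 <;> omega

instance : Finite {e : ℕ × ℕ // C.IsEye e} :=
  ((Set.finite_Iio C.N).prod (Set.finite_Iio C.N)).subset fun _ h => ⟨h.1, h.2.1⟩

variable (C) in
/-- The lattice constructed from a coloured chain. -/
abbrev Lat : Type := C.eyes.Eyed

theorem isUpperModularLattice_lat : IsUpperModularLattice C.Lat := by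
  refine Eyed.isUpperModularLattice covBy_sup_of_covBy (fun e e' h => ?_) fun e z h => ?_
  · rw [eyes_bot, eyes_bot] at h
    simp only [Grid.mk.injEq] at h
    exact Subtype.ext (Prod.ext h.1 h.2)
  · have hbot := e.2.mem (.inl rfl) (.inl rfl)
    have htop := e.2.mem (.inr rfl) (.inr rfl)
    have hl := e.2.mem (.inl rfl) (.inr rfl)
    have hr := e.2.mem (.inr rfl) (.inl rfl)
    rw [eyes_bot, ← pt_eq hbot] at h
    rw [eyes_top, ← pt_eq htop]
    rcases eq_pt_of_covBy hbot h with ⟨-, rfl⟩ | ⟨-, rfl⟩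
    · refine covBy_pt_succ_right hr.1 htop.2.1 fun e => ?_
      rw [pt_eq hr, pt_eq htop] at e
      simp at e
    · refine covBy_pt_succ_left htop.1 hl.2.1 fun e => ?_
      rw [pt_eq hl, pt_eq htop] at e
      simp at e

/-- The comparison is lexicographic because the remainders differ by less than `M`. -/
theorem mul_add_le_mul_add_iff {M a b r s : ℤ} (h1 : r - s < M) (h2 : s - r < M) :
    M * a + r ≤ M * b + s ↔ a < b ∨ a = b ∧ r ≤ s := by
  rcases lt_trichotomy a b with h | rfl | h
  · have : M * (a + 1) ≤ M * b := mul_le_mul_of_nonneg_left h (by omega)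
    simp only [h, true_or, iff_true]
    linarith
  · simp
  · have : M * (b + 1) ≤ M * a := mul_le_mul_of_nonneg_left h (by omega)
    constructor
    · intro; linarith
    · omega

theorem isPlanarOrder_lat : IsPlanarOrder C.Lat := by
  -- Grid coordinates are scaled by `2 * M` so that eyes fit strictly between. The offsets `M -
  -- e.1.2` and `M - e.1.1` decrease in the other coordinate, making distinct eyes in the same row
  -- or column incomparable.
  let M : ℤ := C.N + 1
  let f : C.Lat → ℤ := fun u =>
    Sum.elim (fun p => 2 * M * p.x + 0) (fun e => 2 * M * e.1.1 + (M - e.1.2)) u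
  let g : C.Lat → ℤ := fun u =>
    Sum.elim (fun p => 2 * M * p.y + 0) (fun e => 2 * M * e.1.2 + (M - e.1.1)) u
  have fb : ∀ p, f (base p) = 2 * M * p.x + 0 := fun _ => rfl
  have gb : ∀ p, g (base p) = 2 * M * p.y + 0 := fun _ => rfl
  have fe : ∀ e, f (eye e) = 2 * M * e.1.1 + (M - e.1.2) := fun _ => rfl
  have ge : ∀ e, g (eye e) = 2 * M * e.1.2 + (M - e.1.1) := fun _ => rfl
  have hM : M = C.N + 1 := rfl
  refine isPlanarOrder_of_le_iff (f := fun u => (f u : ℝ)) (g := fun u => (g u : ℝ))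
    fun u v => ?_
  simp only [Int.cast_le]
  rcases base_or_eye u with ⟨p, rfl⟩ | ⟨e, rfl⟩ <;> rcases base_or_eye v with ⟨q, rfl⟩ | ⟨i, rfl⟩
  · rw [fb, fb, gb, gb, mul_add_le_mul_add_iff (by omega) (by omega),
      mul_add_le_mul_add_iff (by omega) (by omega), base_le_base, Grid.le_iff]
    omega
  · obtain ⟨h1, h2, -⟩ := i.2
    rw [fb, gb, fe, ge, mul_add_le_mul_add_iff (by omega) (by omega),
      mul_add_le_mul_add_iff (by omega) (by omega), base_le_iff, lower_eye, eyes_bot, Grid.le_iff]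
    dsimp only
    omega
  · obtain ⟨h1, h2, -⟩ := e.2
    rw [fb, gb, fe, ge, mul_add_le_mul_add_iff (by omega) (by omega),
      mul_add_le_mul_add_iff (by omega) (by omega), le_base_iff, upper_eye, eyes_top, Grid.le_iff]
    dsimp only
    omega
  · obtain ⟨h1, h2, -⟩ := e.2
    obtain ⟨h3, h4, -⟩ := i.2
    rw [fe, fe, ge, ge, mul_add_le_mul_add_iff (by omega) (by omega),
      mul_add_le_mul_add_iff (by omega) (by omega), Eyed.le_iff, upper_eye, lower_eye, eyes_top,
      eyes_bot, Grid.le_iff, eye_injective.eq_iff, Subtype.ext_iff, Prod.ext_iff]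
    dsimp only
    omega

/-! ### The congruence of a set of colours -/

variable (C) in
/-- All steps between `a` and `b` have colours in `I`. -/
def Joined (I : Set P) (a b : ℕ) : Prop :=
  ∀ t, min a b ≤ t → t < max a b → C.color t ∈ I

theorem Joined.refl (I : Set P) (a : ℕ) : C.Joined I a a := fun t _ _ => by omega

theorem Joined.symm {I : Set P} {a b : ℕ} (h : C.Joined I a b) : C.Joined I b a :=
  fun t h1 h2 => h t (by omega) (by omega)

theorem Joined.trans {I : Set P} {a b c : ℕ} (h : C.Joined I a b) (h' : C.Joined I b c) :
    C.Joined I a c := fun t h1 h2 => by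
  by_cases ht : min a b ≤ t ∧ t < max a b
  · exact h t ht.1 ht.2
  · exact h' t (by omega) (by omega)

theorem Joined.min {I : Set P} {a b a' b' : ℕ} (h : C.Joined I a b) (h' : C.Joined I a' b') :
    C.Joined I (min a a') (min b b') := fun t h1 h2 => by
  by_cases ht : Min.min a b ≤ t ∧ t < Max.max a b
  · exact h t ht.1 ht.2
  · exact h' t (by omega) (by omega)

theorem Joined.max {I : Set P} {a b a' b' : ℕ} (h : C.Joined I a b) (h' : C.Joined I a' b') :
    C.Joined I (max a a') (max b b') := fun t h1 h2 => by
  by_cases ht : Min.min a b ≤ t ∧ t < Max.max a b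
  · exact h t ht.1 ht.2
  · exact h' t (by omega) (by omega)

/-- Crossing the fork from below uses the step before `k`, whose colour is at least that of step
`k`. -/
theorem Joined.color_mem {I : LowerSet P} {a b k : ℕ} (h : C.Joined I a b) (hk : C.Fork k)
    (ha : a < k) (hb : k ≤ b) : C.color k ∈ I := by
  obtain ⟨k, rfl⟩ := Nat.exists_eq_succ_of_ne_zero (C.pos hk).ne'
  exact I.lower (C.color_succ_le hk) (h k (by omega) (by omega))

theorem Joined.bump {I : LowerSet P} {a b a' b' : ℕ} (h : C.Joined I a a')
    (h' : C.Joined I b b') : C.Joined I (C.bump a b) (C.bump a' b') := by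
  -- If only `a'` is bumped past the fork, either `a < a'` and the path from `a` has crossed the
  -- fork, or `a = a'` and the path from `b ≤ a` to `b' > a` uses step `a` itself.
  have key : ∀ {a b a' b'}, C.Joined I a a' → C.Joined I b b' → C.bump a b ≤ a' → C.Fork a' →
      a' < b' → C.color a' ∈ I := by
    intro a b a' b' h h' hle hk hlt
    have h1 := C.bump_cases a b
    by_cases ha : a < a'
    · exact h.color_mem hk ha le_rfl
    · obtain rfl : a = a' := by omega
      have : b ≤ a := by
        rcases h1 with h1 | h1
        · omega
        · exact h1.1 hk
      exact h' a (by omega) (by omega)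
  intro t h1 h2
  by_cases ht : Min.min a a' ≤ t ∧ t < Max.max a a'
  · exact h t ht.1 ht.2
  rcases C.bump_cases a b with ⟨k1, k2, k3⟩ | ⟨k1, k3⟩ <;>
    rcases C.bump_cases a' b' with ⟨j1, j2, j3⟩ | ⟨j1, j3⟩
  · by_cases hta : t = a'
    · subst hta
      exact h.color_mem j1 (by omega) le_rfl
    · obtain rfl : t = a := by omega
      exact h.symm.color_mem k1 (by omega) le_rfl
  · obtain rfl : t = a := by omega
    exact key h.symm h'.symm (by omega) k1 k2
  · obtain rfl : t = a' := by omega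
    exact key h h' (by omega) j1 j2
  · omega

variable (C) in
/-- The congruence of the grid that collapses the steps with colours in `I`. -/
noncomputable def gridCon (I : LowerSet P) : LatticeCon C.Grid where
  r p q := C.Joined I p.x q.x ∧ C.Joined I p.y q.y
  iseqv := ⟨fun p => ⟨.refl _ _, .refl _ _⟩, fun h => ⟨h.1.symm, h.2.symm⟩,
    fun h h' => ⟨h.1.trans h'.1, h.2.trans h'.2⟩⟩
  inf h h' := ⟨h.1.min h'.1, h.2.min h'.2⟩
  sup h h' := by
    have hx := (h.1.max h'.1).min (.refl _ C.N)
    have hy := (h.2.max h'.2).min (.refl _ C.N)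
    exact ⟨hx.bump hy, hy.bump hx⟩

theorem joined_succ {I : Set P} {a : ℕ} : C.Joined I a (a + 1) ↔ C.color a ∈ I := by
  refine ⟨fun h => h a (by omega) (by omega), fun h t h1 h2 => ?_⟩
  obtain rfl : t = a := by omega
  exact h

/-- Moving inwards from an end of an eye, or past it on the same side of the order, traverses one of
the two steps of the cell, and these have the same colour. -/
theorem compatible_gridCon (I : LowerSet P) : Compatible C.eyes (C.gridCon I) := by
  have key : ∀ e : {e : ℕ × ℕ // C.IsEye e}, C.color e.1.1 ∈ I →
      (C.gridCon I).r (C.eyes.bot e) (C.eyes.top e) := by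
    intro e h
    rw [eyes_bot, eyes_top]
    exact ⟨joined_succ.2 h, joined_succ.2 (by rw [← e.2.2.2.1]; exact h)⟩
  constructor
  · intro e z hz h
    apply key
    rw [eyes_bot] at hz h
    have hle := Grid.le_iff.1 hz.le
    have hne : ¬ (z.x ≤ e.1.1 ∧ z.y ≤ e.1.2) := fun h => hz.not_ge (Grid.le_iff.2 h)
    obtain ⟨h1, h2⟩ := h
    dsimp only at hle h1 h2
    by_cases hx : e.1.1 < z.x
    · exact h1 _ (by omega) (by omega)
    · rw [e.2.2.2.1]
      exact h2 _ (by omega) (by omega)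
  · intro e z hz h
    apply key
    rw [eyes_top] at hz h
    have hle := Grid.le_iff.1 hz.le
    have hne : ¬ (e.1.1 + 1 ≤ z.x ∧ e.1.2 + 1 ≤ z.y) := fun h => hz.not_ge (Grid.le_iff.2 h)
    obtain ⟨h1, h2⟩ := h
    dsimp only at hle h1 h2
    by_cases hx : z.x < e.1.1 + 1
    · exact h1 _ (by omega) (by omega)
    · rw [e.2.2.2.1]
      exact h2 _ (by omega) (by omega)

variable (C) in
/-- The congruence of the lattice that collapses the steps with colours in `I`. -/
noncomputable def con (I : LowerSet P) : LatticeCon C.Lat := extend (compatible_gridCon I)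

/-! ### The colours collapsed by a congruence -/

section Steps

variable (ψ : LatticeCon C.Grid)

/-- The step `a → a + 1` of the lower right side is collapsed. -/
def Row (a : ℕ) : Prop := ψ.r (pt C.toForkedChain a 0) (pt C.toForkedChain (a + 1) 0)

/-- The step `b → b + 1` of the lower left side is collapsed. -/
def Col (b : ℕ) : Prop := ψ.r (pt C.toForkedChain 0 b) (pt C.toForkedChain 0 (b + 1))

theorem mem_row {a : ℕ} (ha : a ≤ C.N) : C.Mem a 0 :=
  ⟨ha, Nat.zero_le _, fun _ => Nat.zero_le _, fun h => absurd (C.pos h) (lt_irrefl 0)⟩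

theorem mem_col {b : ℕ} (hb : b ≤ C.N) : C.Mem 0 b :=
  ⟨Nat.zero_le _, hb, fun h => absurd (C.pos h) (lt_irrefl 0), fun _ => Nat.zero_le _⟩

variable {ψ}

theorem rel_sup {a b a' b' : ℕ} (c d : ℕ)
    (h : ψ.r (pt C.toForkedChain a b) (pt C.toForkedChain a' b')) :
    ψ.r (pt C.toForkedChain (max a c) (max b d)) (pt C.toForkedChain (max a' c) (max b' d)) := by
  rw [← pt_sup, ← pt_sup]
  exact ψ.sup h (ψ.iseqv.refl _)

theorem rel_inf {a b a' b' c d : ℕ} (hab : C.Mem a b) (hab' : C.Mem a' b') (hcd : C.Mem c d)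
    (h : ψ.r (pt C.toForkedChain a b) (pt C.toForkedChain a' b')) :
    ψ.r (pt C.toForkedChain (min a c) (min b d)) (pt C.toForkedChain (min a' c) (min b' d)) := by
  rw [← pt_inf hab hcd, ← pt_inf hab' hcd]
  exact ψ.inf h (ψ.iseqv.refl _)

/-- The boundary step and the lower edge of the cell are perspective: join with `(0, e.2)` one way,
meet with `(e.1 + 1, 0)` the other. -/
theorem row_iff_cell {e : ℕ × ℕ} (he : C.IsEye e) :
    Row ψ e.1 ↔ ψ.r (pt C.toForkedChain e.1 e.2) (pt C.toForkedChain (e.1 + 1) e.2) := by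
  constructor <;> intro h
  · simpa using rel_sup 0 e.2 h
  · simpa [Row, Col] using rel_inf (he.mem (.inl rfl) (.inl rfl)) (he.mem (.inr rfl) (.inl rfl))
      (mem_row (a := e.1 + 1) he.1) h

theorem col_iff_cell {e : ℕ × ℕ} (he : C.IsEye e) :
    Col ψ e.2 ↔ ψ.r (pt C.toForkedChain e.1 e.2) (pt C.toForkedChain e.1 (e.2 + 1)) := by
  constructor <;> intro h
  · simpa using rel_sup e.1 0 h
  · simpa [Row, Col] using rel_inf (he.mem (.inl rfl) (.inl rfl)) (he.mem (.inl rfl) (.inr rfl))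
      (mem_col (b := e.2 + 1) he.2.1) h

/-- At height `k + 2` the point with first coordinate `k + 1` is deleted, so the image of step `k`
spans two units. Projecting back to height `0` collapses step `k + 1` as well. -/
theorem Row.of_fork {k : ℕ} (hk : C.Fork (k + 1)) (h : Row ψ k) : Row ψ (k + 1) := by
  have hN := C.lt hk
  have hnot : ¬ C.Fork (k + 2) := C.isolated hk
  have h1 : ψ.r (pt C.toForkedChain k (k + 2)) (pt C.toForkedChain (k + 1) (k + 2)) := by
    simpa using rel_sup 0 (k + 2) h
  have hm : C.Mem k (k + 2) :=
    ⟨by omega, hN, fun h => absurd hk (C.isolated h), fun h => absurd h hnot⟩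
  have hm' : C.Mem (k + 2) (k + 2) := ⟨hN, hN, fun _ => le_rfl, fun _ => le_rfl⟩
  have e : pt C.toForkedChain (k + 1) (k + 2) = pt C.toForkedChain (k + 2) (k + 2) := by
    refine eq_of_forall_ge_iff fun p => ?_
    rw [pt_le_iff (by omega) hN, pt_le_iff hN hN]
    refine ⟨fun hp => ⟨?_, hp.2⟩, fun hp => ⟨by omega, hp.2⟩⟩
    rcases hp.1.eq_or_lt with e | e
    · have := p.mem.2.2.1 (e ▸ hk)
      omega
    · exact e
  rw [e] at h1
  have h2 := rel_sup (k + 1) 0 (rel_inf hm hm' (mem_row hN) h1)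
  simpa [Row] using h2

theorem pt_fork_right {k : ℕ} (hk : C.Fork k) :
    pt C.toForkedChain (k + 1) k = pt C.toForkedChain (k + 1) (k + 1) := by
  have hN := C.lt hk
  refine eq_of_forall_ge_iff fun p => ?_
  rw [pt_le_iff hN hN.le, pt_le_iff hN hN]
  refine ⟨fun hp => ⟨hp.1, ?_⟩, fun hp => ⟨hp.1, by omega⟩⟩
  rcases hp.2.eq_or_lt with e | e
  · have := p.mem.2.2.2 (e ▸ hk)
    omega
  · exact e

theorem pt_fork_left {k : ℕ} (hk : C.Fork k) :
    pt C.toForkedChain k (k + 1) = pt C.toForkedChain (k + 1) (k + 1) := by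
  have hN := C.lt hk
  refine eq_of_forall_ge_iff fun p => ?_
  rw [pt_le_iff hN.le hN, pt_le_iff hN hN]
  refine ⟨fun hp => ⟨?_, hp.2⟩, fun hp => ⟨by omega, hp.2⟩⟩
  rcases hp.1.eq_or_lt with e | e
  · have := p.mem.2.2.1 (e ▸ hk)
    omega
  · exact e

/-- Both steps project up to the edge from `(k, k)` to `(k + 1, k + 1)`, the only one leaving the
fork point upwards. -/
theorem row_iff_col_of_fork {k : ℕ} (hk : C.Fork k) : Row ψ k ↔ Col ψ k := by
  have hN := C.lt hk
  have hm : C.Mem k k := ⟨hN.le, hN.le, fun _ => le_rfl, fun _ => le_rfl⟩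
  have hm' : C.Mem (k + 1) (k + 1) := ⟨hN, hN, fun _ => le_rfl, fun _ => le_rfl⟩
  constructor <;> intro h
  · have h1 := rel_sup 0 k h
    simp only [Nat.zero_le, sup_of_le_left, sup_of_le_right, pt_fork_right hk] at h1
    simpa [Row, Col] using rel_inf hm hm' (mem_col (b := k + 1) hN) h1
  · have h1 := rel_sup k 0 h
    simp only [Nat.zero_le, sup_of_le_left, sup_of_le_right, pt_fork_left hk] at h1
    simpa [Row, Col] using rel_inf hm hm' (mem_row (a := k + 1) hN) h1

theorem row_of_rel {a b t : ℕ} (hb : b ≤ C.N) (hat : a ≤ t) (htb : t < b)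
    (h : ψ.r (pt C.toForkedChain a 0) (pt C.toForkedChain b 0)) : Row ψ t := by
  have h1 := rel_sup t 0 h
  rw [max_eq_right hat, max_eq_left htb.le, max_self] at h1
  have h2 := rel_inf (mem_row (by omega)) (mem_row hb) (mem_row (a := t + 1) (by omega)) h1
  rwa [min_eq_left (by omega : t ≤ t + 1), min_eq_right (by omega : t + 1 ≤ b), min_self] at h2

theorem col_of_rel {a b t : ℕ} (hb : b ≤ C.N) (hat : a ≤ t) (htb : t < b)
    (h : ψ.r (pt C.toForkedChain 0 a) (pt C.toForkedChain 0 b)) : Col ψ t := by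
  have h1 := rel_sup 0 t h
  rw [max_eq_right hat, max_eq_left htb.le, max_self] at h1
  have h2 := rel_inf (mem_col (by omega)) (mem_col hb) (mem_col (b := t + 1) (by omega)) h1
  rwa [min_eq_left (by omega : t ≤ t + 1), min_eq_right (by omega : t + 1 ≤ b), min_self] at h2

theorem rel_of_row {a b : ℕ} (hab : a ≤ b) (h : ∀ t, a ≤ t → t < b → Row ψ t) :
    ψ.r (pt C.toForkedChain a 0) (pt C.toForkedChain b 0) := by
  induction b, hab using Nat.le_induction with
  | base => exact ψ.iseqv.refl _
  | succ b hb ih =>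
    exact ψ.iseqv.trans (ih fun t h1 h2 => h t h1 (by omega)) (h b hb (by omega))

theorem rel_of_col {a b : ℕ} (hab : a ≤ b) (h : ∀ t, a ≤ t → t < b → Col ψ t) :
    ψ.r (pt C.toForkedChain 0 a) (pt C.toForkedChain 0 b) := by
  induction b, hab using Nat.le_induction with
  | base => exact ψ.iseqv.refl _
  | succ b hb ih =>
    exact ψ.iseqv.trans (ih fun t h1 h2 => h t h1 (by omega)) (h b hb (by omega))

/-- A congruence of the grid is determined by the steps that it collapses on the lower sides. -/
theorem le_of_row_of_col {ψ' : LatticeCon C.Grid} (hrow : ∀ t < C.N, Row ψ t → Row ψ' t)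
    (hcol : ∀ t < C.N, Col ψ t → Col ψ' t) : ψ ≤ ψ' := by
  have hx : ∀ {a b}, a ≤ b → b ≤ C.N → ψ.r (pt C.toForkedChain a 0) (pt C.toForkedChain b 0) →
      ψ'.r (pt C.toForkedChain a 0) (pt C.toForkedChain b 0) := fun hab hb h =>
    rel_of_row hab fun t h1 h2 => hrow t (by omega) (row_of_rel hb h1 h2 h)
  have hy : ∀ {a b}, a ≤ b → b ≤ C.N → ψ.r (pt C.toForkedChain 0 a) (pt C.toForkedChain 0 b) →
      ψ'.r (pt C.toForkedChain 0 a) (pt C.toForkedChain 0 b) := fun hab hb h =>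
    rel_of_col hab fun t h1 h2 => hcol t (by omega) (col_of_rel hb h1 h2 h)
  intro p q h
  rw [← pt_coords p, ← pt_coords q] at h ⊢
  -- Meets with `(N, 0)` and `(0, N)` project onto the lower sides; `p` is recovered as the join of
  -- its projections.
  have h1 := rel_inf p.mem q.mem (mem_row le_rfl) h
  have h2 := rel_inf p.mem q.mem (mem_col le_rfl) h
  simp only [min_eq_left p.mem.1, min_eq_left q.mem.1, Nat.zero_le, inf_of_le_right] at h1
  simp only [min_eq_left p.mem.2.1, min_eq_left q.mem.2.1, Nat.zero_le, inf_of_le_right] at h2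
  have h3 : ψ'.r (pt C.toForkedChain p.x 0) (pt C.toForkedChain q.x 0) := by
    rcases le_total p.x q.x with hle | hle
    · exact hx hle q.mem.1 h1
    · exact ψ'.iseqv.symm (hx hle p.mem.1 (ψ.iseqv.symm h1))
  have h4 : ψ'.r (pt C.toForkedChain 0 p.y) (pt C.toForkedChain 0 q.y) := by
    rcases le_total p.y q.y with hle | hle
    · exact hy hle q.mem.2.1 h2
    · exact ψ'.iseqv.symm (hy hle p.mem.2.1 (ψ.iseqv.symm h2))
  have h5 := ψ'.sup h3 h4
  simpa [pt_sup] using h5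

end Steps

section Iso

variable (θ : LatticeCon C.Lat)

theorem row_iff_col_of_isEye {e : ℕ × ℕ} (he : C.IsEye e) :
    Row (restrict θ) e.1 ↔ Col (restrict θ) e.2 := by
  rw [row_iff_cell he, col_iff_cell he]
  have h := bot_left_iff_bot_right θ (e := ⟨e, he⟩)
  rw [eyes_bot, ← pt_eq] at h
  exact h.symm

/-- Eyes tie both steps to the same step `z < n` of the second coordinate, of the common colour. -/
theorem row_iff_row {x y : ℕ} (hx : x < C.N) (hy : y < C.N) (h : C.color x = C.color y) :
    Row (restrict θ) x ↔ Row (restrict θ) y := by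
  obtain ⟨z, hz, e⟩ := C.exists_color (C.color x)
  have hzN := hz.trans_le C.n_le
  exact (row_iff_col_of_isEye θ (e := (x, z)) ⟨hx, hzN, e.symm, .inl hz⟩).trans
    (row_iff_col_of_isEye θ (e := (y, z)) ⟨hy, hzN, h.symm.trans e.symm, .inl hz⟩).symm

theorem row_iff_col {x : ℕ} (hx : x < C.N) : Row (restrict θ) x ↔ Col (restrict θ) x := by
  by_cases h : x < C.n
  · exact row_iff_col_of_isEye θ (e := (x, x)) ⟨hx, hx, rfl, .inl h⟩
  · rcases C.fork_or (not_lt.1 h) hx with h | h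
    · exact row_iff_col_of_isEye θ (e := (x, x)) ⟨hx, hx, rfl, .inr ⟨rfl, h⟩⟩
    · exact row_iff_col_of_fork h

/-- The colours of the steps that a congruence collapses. -/
def colors : LowerSet P where
  carrier := {p | ∃ x < C.N, C.color x = p ∧ Row (restrict θ) x}
  lower' := by
    rintro p q hqp ⟨x, hx, rfl, h⟩
    obtain ⟨k, hk, e, rfl⟩ := C.exists_fork hqp
    have hN := C.lt hk
    exact ⟨k + 1, hN, rfl, ((row_iff_row θ hx (by omega) e.symm).1 h).of_fork hk⟩

theorem mem_colors_iff {x : ℕ} (hx : x < C.N) : C.color x ∈ colors θ ↔ Row (restrict θ) x :=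
  ⟨fun ⟨_, hy, e, h⟩ => (row_iff_row θ hy hx e).1 h, fun h => ⟨x, hx, rfl, h⟩⟩

theorem colors_le_colors_iff {θ θ' : LatticeCon C.Lat} : colors θ ≤ colors θ' ↔ θ ≤ θ' := by
  constructor
  · intro h
    have hrow : ∀ t < C.N, Row (restrict θ) t → Row (restrict θ') t := fun t ht h' =>
      (mem_colors_iff θ' ht).1 (h ((mem_colors_iff θ ht).2 h'))
    exact le_of_restrict_le (le_of_row_of_col hrow fun t ht h' =>
      (row_iff_col θ' ht).1 (hrow t ht ((row_iff_col θ ht).2 h')))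
  · rintro h p ⟨x, hx, e, h'⟩
    exact ⟨x, hx, e, h h'⟩

theorem colors_con (I : LowerSet P) : colors (C.con I) = I := by
  ext p
  obtain ⟨x, hx, rfl⟩ := C.exists_color p
  have hN := hx.trans_le C.n_le
  refine (mem_colors_iff _ hN).trans ((extend_base_iff (compatible_gridCon I)).trans ?_)
  rw [pt_eq (mem_row hN.le), pt_eq (mem_row hN)]
  exact (and_iff_left (Joined.refl _ _)).trans joined_succ

variable (C) in
/-- The congruences of the lattice correspond to the lower sets of colours. -/
noncomputable def conIso : LatticeCon C.Lat ≃o LowerSet P :=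
  RelIso.ofSurjective (OrderEmbedding.ofMapLEIff colors fun _ _ => colors_le_colors_iff)
    fun I => ⟨C.con I, colors_con I⟩

end Iso

end ColoredChain

/-! ### Existence of coloured chains and the representation theorem. -/

theorem exists_nat_enumeration (α : Type*) [Finite α] [Nonempty α] :
    ∃ (n : ℕ) (g : ℕ → α), ∀ a, ∃ i < n, g i = a := by
  obtain ⟨n, ⟨e⟩⟩ := Finite.exists_equiv_fin α
  refine ⟨n, fun i => if h : i < n then e.symm ⟨i, h⟩ else Classical.arbitrary α,
    fun a => ⟨e a, (e a).2, ?_⟩⟩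
  simp

theorem nonempty_coloredChain (P : Type*) [Preorder P] [Finite P] [Nonempty P] :
    Nonempty (ColoredChain P) := by
  obtain ⟨n, g, hg⟩ := exists_nat_enumeration P
  have : Nonempty {p : P × P // p.1 ≤ p.2} := (‹Nonempty P›).map fun a => ⟨(a, a), le_rfl⟩
  obtain ⟨m, k, hk⟩ := exists_nat_enumeration {p : P × P // p.1 ≤ p.2}
  -- After the `n` steps listing `P`, the pair `k j` occupies steps `n + 2 * j` (larger colour) and
  -- `n + 2 * j + 1` (smaller colour), with the fork at the point between them.
  let c : ℕ → P := fun x => if x < n then g x else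
    if (x - n) % 2 = 0 then (k ((x - n) / 2)).1.2 else (k ((x - n) / 2)).1.1
  have hc0 : ∀ j, c (n + 2 * j) = (k j).1.2 := by
    intro j
    have h1 : (n + 2 * j - n) % 2 = 0 := by omega
    have h2 : (n + 2 * j - n) / 2 = j := by omega
    simp only [c, h1, h2, if_neg (by omega : ¬ n + 2 * j < n), if_true]
  have hc1 : ∀ j, c (n + 2 * j + 1) = (k j).1.1 := by
    intro j
    have h1 : ¬ (n + 2 * j + 1 - n) % 2 = 0 := by omega
    have h2 : (n + 2 * j + 1 - n) / 2 = j := by omega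
    simp only [c, h1, h2, if_neg (by omega : ¬ n + 2 * j + 1 < n), if_false]
  refine ⟨{
    N := n + 2 * m
    Fork := fun x => ∃ j < m, x = n + 2 * j + 1
    pos := by rintro x ⟨j, hj, rfl⟩; omega
    lt := by rintro x ⟨j, hj, rfl⟩; omega
    isolated := by rintro x ⟨j, hj, rfl⟩ ⟨i, hi, h⟩; omega
    n := n
    color := c
    n_le := by omega
    lt_of_fork := by rintro x ⟨j, hj, rfl⟩; omega
    fork_or := ?_
    color_succ_le := ?_
    exists_color := ?_
    exists_fork := ?_ }⟩
  · intro x h1 h2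
    rcases Nat.mod_two_eq_zero_or_one (x - n) with h | h
    · exact .inl ⟨(x - n) / 2, by omega, by omega⟩
    · exact .inr ⟨(x - n) / 2, by omega, by omega⟩
  · rintro x ⟨j, hj, h⟩
    obtain rfl : x = n + 2 * j := by omega
    rw [hc0, hc1]
    exact (k j).2
  · intro p
    obtain ⟨i, hi, rfl⟩ := hg p
    exact ⟨i, hi, if_pos hi⟩
  · intro p q hpq
    obtain ⟨j, hj, e⟩ := hk ⟨(p, q), hpq⟩
    refine ⟨n + 2 * j, ⟨j, hj, rfl⟩, ?_, ?_⟩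
    · rw [hc0, e]
    · rw [hc1, e]

theorem exists_planar_semimodular_of_poset (P : Type*) [Preorder P] [Finite P] :
    ∃ (K : Type) (_ : Lattice K), Finite K ∧ Nonempty K ∧ IsPlanarOrder K ∧
      IsUpperModularLattice K ∧ Nonempty (LowerSet P ≃o LatticeCon K) := by
  rcases isEmpty_or_nonempty P with hP | hP
  -- An empty `P` leaves no colours for a chain; the one-element lattice serves.
  · have hsub : ∀ θ θ' : LatticeCon PUnit.{1}, θ ≤ θ' := fun θ θ' x y _ => θ'.iseqv.refl x
    refine ⟨PUnit, inferInstance, inferInstance, inferInstance,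
      isPlanarOrder_of_le_iff (f := fun _ => 0) (g := fun _ => 0) fun _ _ => by simp,
      ⟨fun {a b} h => absurd h.lt (lt_irrefl a)⟩, ⟨?_⟩⟩
    exact
      { toFun := fun _ => ⊤
        invFun := fun _ => ⊤
        left_inv := fun I => by ext p; exact hP.elim p
        right_inv := fun θ => le_antisymm (hsub _ _) (hsub _ _)
        map_rel_iff' := fun {I J} => ⟨fun _ p => hP.elim p, fun _ => hsub _ _⟩ }
  · obtain ⟨C⟩ := nonempty_coloredChain P
    exact ⟨C.Lat, inferInstance, inferInstance, ⟨EyeFamily.Eyed.base (ForkedChain.Grid.pt _ 0 0)⟩,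
      ColoredChain.isPlanarOrder_lat, ColoredChain.isUpperModularLattice_lat, ⟨C.conIso.symm⟩⟩

theorem theorem1 {D : Type*} [DistribLattice D] [Finite D] [Nonempty D] :
    ∃ (K : Type) (_ : Lattice K), Finite K ∧ Nonempty K ∧ IsPlanarOrder K ∧
      IsUpperModularLattice K ∧ Nonempty (D ≃o LatticeCon K) := by
  classical
  have := Fintype.ofFinite D
  let _ : OrderBot D := Fintype.toOrderBot D
  obtain ⟨K, hK, h1, h2, h3, h4, ⟨e⟩⟩ :=
    exists_planar_semimodular_of_poset {a : D // SupIrred a}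
  exact ⟨K, hK, h1, h2, h3, h4, ⟨OrderIso.lowerSetSupIrred.trans e⟩⟩
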